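/- Let $d\ge 1$, $\mathbb T^d=(\mathbb R/\mathbb Z)^d$, $H^0=L^2(\mathbb T^d;\mathbb C)$, and let $H^2\subset H^0$ be the Sobolev space of order $2$. For $\lambda\in[0,1)$ let $K_1^\lambda,K_2^\lambda,K^\lambda$ be bounded operators on $H^0$, with $K_1^\lambda$ and $K_2^\lambda$ selfadjoint. Assume that each of the three families is uniformly bounded in operator norm and strongly continuous on $[0,1)$, i.e. for all $s\in[0,1)$ and $u\in H^0$, $K^\lambda u\to K^{s}u$ in $H^0$ as $\lambda\to s$, and likewise for $K_1^\lambda,K_2^\lambda$. Put $A_i^\lambda=-\Delta+K_i^\lambda$ ($i=1,2$), with domain $H^2$, and $$M^\lambda=\begin{pmatrix}A_1^\lambda & K^\lambda\\ (K^\lambda)^* & -A_2^\lambda\end{pmatrix}$$ in $H^0\oplus H^0$, with domain $H^2\oplus H^2$. Let $(\alpha_j,v_j)_{j\ge1}$ and $(\beta_j,w_j)_{j\ge1}$ be enumerations, in ascending order and counting multiplicity, of the eigenvalues and orthonormal eigenfunctions of $A_1^0$ and $A_2^0$ respectively. Let $P_n$ and $Q_n$ be the orthogonal projections of $H^0$ onto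 $\operatorname{span}\{v_1,\dots,v_n\}$ and $\operatorname{span}\{w_1,\dots,w_n\}$, and let $$M_n^\lambda=\begin{pmatrix}P_nA_1^\lambda P_n & P_nK^\lambda Q_n\\ Q_n(K^\lambda)^*P_n & -Q_nA_2^\lambda Q_n\end{pmatrix},$$ regarded as an operator in the finite-dimensional space $R(P_n)\oplus R(Q_n)$, where $R(\cdot)$ denotes the range. Let $\sigma\in\mathbb C$. If there are positive integers $n_k\to\infty$ and $\lambda_k\in[0,1)$ with $\lambda_k\to\lambda_0\in[0,1)$ such that $\sigma$ is in the spectrum of $M_{n_k}^{\lambda_k}$ for every $k$, then $\sigma$ is in the spectrum of $M^{\lambda_0}$. -/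

import Mathlib

open MeasureTheory Filter Topology

noncomputable section

namespace TruncatedOperators

/-- `H⁰ = L²(𝕋ᵈ; ℂ)`, where `𝕋ᵈ = (ℝ/ℤ)ᵈ` carries its Haar probability measure. -/
abbrev H0 (d : ℕ) : Type :=
  Lp ℂ 2 (Measure.pi fun _ : Fin d => (AddCircle.haarAddCircle : Measure UnitAddCircle))

/-- The `k`-th Fourier coefficient `∫ f(x) e^{-2πi k·x} dx` of `f ∈ L²(𝕋ᵈ)`. -/
def fourierCoef {d : ℕ} (f : H0 d) (k : Fin d → ℤ) : ℂ :=
  UnitAddTorus.mFourierBasis.repr f k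

/-- The Fourier symbol `|2πk|²` of `-Δ` on `𝕋ᵈ`. -/
def laplaceSymbol {d : ℕ} (k : Fin d → ℤ) : ℝ :=
  (2 * Real.pi) ^ 2 * ∑ i, (k i : ℝ) ^ 2

lemma laplaceSymbol_nonneg {d : ℕ} (k : Fin d → ℤ) : 0 ≤ laplaceSymbol k := by
  unfold laplaceSymbol; positivity

lemma fourierCoef_add {d : ℕ} (f g : H0 d) (k : Fin d → ℤ) :
    fourierCoef (f + g) k = fourierCoef f k + fourierCoef g k := by
  simp [fourierCoef]

lemma fourierCoef_smul {d : ℕ} (c : ℂ) (f : H0 d) (k : Fin d → ℤ) :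
    fourierCoef (c • f) k = c * fourierCoef f k := by
  simp [fourierCoef]

/-- The Sobolev space `Hˢ(𝕋ᵈ)` of order `s ∈ ℕ`, as a subspace of `H⁰`:
the `f` with `∑ₖ (1 + |2πk|²)ˢ |f̂(k)|² < ∞`. -/
def sobolev (d s : ℕ) : Submodule ℂ (H0 d) where
  carrier := {f | Summable fun k : Fin d → ℤ =>
    (1 + laplaceSymbol k) ^ s * ‖fourierCoef f k‖ ^ 2}
  zero_mem' := by simp [fourierCoef, summable_zero]
  add_mem' := by
    intro f g hf hg
    refine Summable.of_nonneg_of_le (fun k => ?_) (fun k => ?_)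
      ((hf.mul_left 2).add (hg.mul_left 2))
    · have := laplaceSymbol_nonneg k
      positivity
    · have h1 : 0 ≤ (1 + laplaceSymbol k) ^ s := by
        have := laplaceSymbol_nonneg k
        positivity
      have h2 : ‖fourierCoef (f + g) k‖ ^ 2
          ≤ 2 * ‖fourierCoef f k‖ ^ 2 + 2 * ‖fourierCoef g k‖ ^ 2 := by
        rw [fourierCoef_add]
        have h3 := norm_add_le (fourierCoef f k) (fourierCoef g k)
        have h4 := norm_nonneg (fourierCoef f k + fourierCoef g k)
        nlinarith [sq_nonneg (‖fourierCoef f k‖ - ‖fourierCoef g k‖)]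
      calc _ ≤ (1 + laplaceSymbol k) ^ s
            * (2 * ‖fourierCoef f k‖ ^ 2 + 2 * ‖fourierCoef g k‖ ^ 2) := by gcongr
        _ = _ := by ring
  smul_mem' := by
    intro c f hf
    refine (hf.mul_left (‖c‖ ^ 2)).congr (fun k => ?_)
    rw [fourierCoef_smul, norm_mul]
    ring

/-- `H²(𝕋ᵈ)`. -/
abbrev H2 (d : ℕ) : Submodule ℂ (H0 d) := sobolev d 2

lemma memℓp_laplace {d : ℕ} (f : H2 d) :
    Memℓp (fun k : Fin d → ℤ => (laplaceSymbol k : ℂ) * fourierCoef (f : H0 d) k) 2 := by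
  refine memℓp_gen ?_
  have hf : Summable fun k : Fin d → ℤ =>
    (1 + laplaceSymbol k) ^ 2 * ‖fourierCoef (f : H0 d) k‖ ^ 2 := f.2
  refine Summable.of_nonneg_of_le (fun k => by positivity) (fun k => ?_) hf
  have h := laplaceSymbol_nonneg k
  simp only [ENNReal.toReal_ofNat, Real.rpow_ofNat, norm_mul, Complex.norm_real,
    Real.norm_eq_abs, abs_of_nonneg h, mul_pow]
  gcongr
  linarith

/-- `-Δ : H² → H⁰`, the Fourier multiplier with symbol `|2πk|²`. -/
def negLaplacian (d : ℕ) : H2 d →ₗ[ℂ] H0 d where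
  toFun f := UnitAddTorus.mFourierBasis.repr.symm ⟨_, memℓp_laplace f⟩
  map_add' f g := by
    rw [← map_add]
    congr 1
    ext k
    simp only [Submodule.coe_add, fourierCoef_add, mul_add, lp.coeFn_add, Pi.add_apply]
  map_smul' c f := by
    rw [RingHom.id_apply, ← map_smul]
    congr 1
    ext k
    simp only [Submodule.coe_smul, fourierCoef_smul, lp.coeFn_smul, Pi.smul_apply, smul_eq_mul]
    ring

/-- The Schrödinger operator `-Δ + K` in `H⁰`, with domain `H²`. -/
def schrodinger {d : ℕ} (K : H0 d →L[ℂ] H0 d) : H2 d →ₗ[ℂ] H0 d :=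
  negLaplacian d + (K : H0 d →ₗ[ℂ] H0 d) ∘ₗ (H2 d).subtype

/-- The operator matrix
`M = [ -Δ + K₁ , K ; K* , -(-Δ + K₂) ]` in `H⁰ ⊕ H⁰`, with domain `H² ⊕ H²`. -/
def matrixOp {d : ℕ} (K₁ K₂ K : H0 d →L[ℂ] H0 d) :
    WithLp 2 (H0 d × H0 d) →ₗ.[ℂ] WithLp 2 (H0 d × H0 d) where
  domain := ((H2 d).prod (H2 d)).comap (WithLp.linearEquiv 2 ℂ (H0 d × H0 d)).toLinearMap
  toFun :=
    { toFun := fun u => WithLp.toLp 2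
        (schrodinger K₁ ⟨u.1.fst, u.2.1⟩ + K u.1.snd,
          K.adjoint u.1.fst - schrodinger K₂ ⟨u.1.snd, u.2.2⟩)
      map_add' := by
        intro u v
        have h1 : (⟨(u + v).1.fst, (u + v).2.1⟩ : H2 d)
          = ⟨u.1.fst, u.2.1⟩ + ⟨v.1.fst, v.2.1⟩ := rfl
        have h2 : (⟨(u + v).1.snd, (u + v).2.2⟩ : H2 d)
          = ⟨u.1.snd, u.2.2⟩ + ⟨v.1.snd, v.2.2⟩ := rfl
        rw [h1, h2, ← WithLp.toLp_add]
        congr 1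
        ext1
        · simp only [map_add, Submodule.coe_add, WithLp.add_snd, Prod.mk_add_mk]
          abel
        · simp only [map_add, Submodule.coe_add, WithLp.add_fst, Prod.mk_add_mk]
          abel
      map_smul' := by
        intro c u
        have h1 : (⟨(c • u).1.fst, (c • u).2.1⟩ : H2 d) = c • ⟨u.1.fst, u.2.1⟩ := rfl
        have h2 : (⟨(c • u).1.snd, (c • u).2.2⟩ : H2 d) = c • ⟨u.1.snd, u.2.2⟩ := rfl
        rw [h1, h2, RingHom.id_apply, ← WithLp.toLp_smul]
        congr 1
        ext1 <;> simp [smul_add, smul_sub] }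

/-- The resolvent set of an unbounded operator `T`: the `z` for which `T - z : D(T) → E` has a
bounded everywhere defined two-sided inverse `R`. -/
def resolventSetPMap {E : Type*} [NormedAddCommGroup E] [NormedSpace ℂ E]
    (T : E →ₗ.[ℂ] E) : Set ℂ :=
  {z | ∃ R : E →L[ℂ] E,
    (∀ y : E, ∃ x : T.domain, (x : E) = R y ∧ T x - z • (x : E) = y) ∧
    ∀ x : T.domain, R (T x - z • (x : E)) = x}

/-- The spectrum of an unbounded operator. -/
def spectrumPMap {E : Type*} [NormedAddCommGroup E] [NormedSpace ℂ E]
    (T : E →ₗ.[ℂ] E) : Set ℂ :=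
  (resolventSetPMap T)ᶜ

/-- `(α 0, v 0), (α 1, v 1), …` is an enumeration of eigenvalues and orthonormal eigenvectors of
`T : H² → H⁰` in ascending order and counting multiplicity: for every `n`, any eigenvector that is
orthogonal to `v 0, …, v (n-1)` belongs to an eigenvalue `≥ α n`. -/
structure IsEigenEnumeration {d : ℕ} (T : H2 d →ₗ[ℂ] H0 d) (α : ℕ → ℝ) (v : ℕ → H2 d) :
    Prop where
  orthonormal : Orthonormal ℂ fun j => (v j : H0 d)
  eigen : ∀ j, T (v j) = (α j : ℂ) • (v j : H0 d)
  ascending : Monotone α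
  first : ∀ (n : ℕ) (μ : ℝ) (x : H2 d), x ≠ 0 → T x = (μ : ℂ) • (x : H0 d) →
    (∀ j < n, inner ℂ (v j : H0 d) (x : H0 d) = 0) → α n ≤ μ

/-- The span of `v 0, …, v (n-1)`, i.e. the range of the projection `P_n`. -/
def firstSpan {d : ℕ} (v : ℕ → H2 d) (n : ℕ) : Submodule ℂ (H0 d) :=
  Submodule.span ℂ (Set.range fun j : Fin n => (v j : H0 d))

instance {d : ℕ} (v : ℕ → H2 d) (n : ℕ) : FiniteDimensional ℂ (firstSpan v n) :=
  FiniteDimensional.span_of_finite ℂ (Set.finite_range _)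

lemma firstSpan_le {d : ℕ} (v : ℕ → H2 d) (n : ℕ) : firstSpan v n ≤ H2 d := by
  rw [firstSpan, Submodule.span_le]
  rintro _ ⟨j, rfl⟩
  exact (v j).2

/-- `P_n A P_n`, acting in the range of `P_n`. -/
def truncDiag {d : ℕ} (A : H2 d →ₗ[ℂ] H0 d) (v : ℕ → H2 d) (n : ℕ) :
    firstSpan v n →ₗ[ℂ] firstSpan v n :=
  (firstSpan v n).orthogonalProjectionOnto.toLinearMap ∘ₗ A ∘ₗ
    Submodule.inclusion (firstSpan_le v n)

/-- `P_n K Q_n`, acting from the range of `Q_n` (the span of `w 0, …, w (n-1)`) to the range of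
`P_n` (the span of `v 0, …, v (n-1)`). -/
def truncOffDiag {d : ℕ} (K : H0 d →L[ℂ] H0 d) (v w : ℕ → H2 d) (n : ℕ) :
    firstSpan w n →ₗ[ℂ] firstSpan v n :=
  (firstSpan v n).orthogonalProjectionOnto.toLinearMap ∘ₗ (K : H0 d →ₗ[ℂ] H0 d) ∘ₗ
    (firstSpan w n).subtype

/-- The truncated operator matrix
`M_n = [ P_n (-Δ + K₁) P_n , P_n K Q_n ; Q_n K* P_n , -Q_n (-Δ + K₂) Q_n ]`,
an operator in the finite-dimensional space `R(P_n) ⊕ R(Q_n)`. -/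
def truncMatrixOp {d : ℕ} (K₁ K₂ K : H0 d →L[ℂ] H0 d) (v w : ℕ → H2 d) (n : ℕ) :
    Module.End ℂ (WithLp 2 (firstSpan v n × firstSpan w n)) :=
  (WithLp.linearEquiv 2 ℂ (firstSpan v n × firstSpan w n)).symm.toLinearMap ∘ₗ
    LinearMap.prod
      (LinearMap.coprod (truncDiag (schrodinger K₁) v n) (truncOffDiag K v w n))
      (LinearMap.coprod (truncOffDiag K.adjoint w v n) (-truncDiag (schrodinger K₂) w n)) ∘ₗ
    (WithLp.linearEquiv 2 ℂ (firstSpan v n × firstSpan w n)).toLinearMap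

/-- A family of bounded operators `K^λ`, `λ ∈ [0,1)`, on `H⁰` that is uniformly bounded and
strongly continuous in `λ`. -/
structure IsAdmissibleFamily {d : ℕ} (K : Set.Ico (0 : ℝ) 1 → H0 d →L[ℂ] H0 d) : Prop where
  bounded : ∃ C : ℝ, ∀ l, ‖K l‖ ≤ C
  strong : ∀ (s : Set.Ico (0 : ℝ) 1) (u : H0 d), Tendsto (fun l => K l u) (𝓝 s) (𝓝 (K s u))

end TruncatedOperators

end

open TruncatedOperators

/-! The spectrum of a finite matrix consists of eigenvalues, so each truncation yields a unit
eigenvector `(u, z)`, and compactness turns a sequence of these into an eigenvector of the limit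
operator. The range of `P_n` is spanned by eigenfunctions of `A₁⁰`, hence invariant under it, so the
first row reads `A₁⁰ u = P_n (σ u - K^λ z + (K₁⁰ - K₁^λ) u)`. The right side involves only bounded
operators, which bounds `-Δ u` uniformly (`IsEigenEnumeration.negLaplacian_eq`,
`norm_negLaplacian_le`). The second row is treated in the same way. By Rellich
(`exists_subseq_tendsto_of_bounded`) a subsequence converges strongly, so the limit still has norm
one.

To pass to the limit in the equation one needs `P_n → 1` strongly, that is, completeness of the
eigenfunctions (`IsEigenEnumeration.orthogonal_span_eq_bot`). The limit is taken weakly, on each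
Fourier coefficient (`exists_negLaplacian_eq_of_tendsto`), since the adjoints `(K^λ)*` need not
converge strongly. -/

namespace TruncatedOperators

/-! ### Diagonal operators in a Hilbert basis. -/

section HilbertBasis

variable {ι E : Type*} [NormedAddCommGroup E] [InnerProductSpace ℂ E]

lemma norm_le_mul_of_repr_le (b : HilbertBasis ι ℂ E) {f g : E} {C : ℝ} (hC : 0 ≤ C)
    (h : ∀ i, ‖b.repr g i‖ ≤ C * ‖b.repr f i‖) : ‖g‖ ≤ C * ‖f‖ := by
  have hp : 0 < (2 : ENNReal).toReal := by norm_num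
  rw [← b.repr.norm_map g, ← b.repr.norm_map f]
  refine lp.norm_le_of_tsum_le hp (by positivity) ?_
  rw [Real.mul_rpow hC (norm_nonneg _), lp.norm_rpow_eq_tsum hp, ← tsum_mul_left]
  refine Summable.tsum_le_tsum (fun i => ?_) ((lp.memℓp (b.repr g)).summable hp)
    (((lp.memℓp (b.repr f)).summable hp).mul_left _)
  rw [← Real.mul_rpow hC (norm_nonneg _)]
  exact Real.rpow_le_rpow (norm_nonneg _) (h i) hp.le

lemma exists_diagonal (b : HilbertBasis ι ℂ E) (m : ι → ℂ) {C : ℝ} (hC : 0 ≤ C)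
    (hm : ∀ i, ‖m i‖ ≤ C) :
    ∃ T : E →L[ℂ] E, (∀ f i, b.repr (T f) i = m i * b.repr f i) ∧ ‖T‖ ≤ C := by
  have hp : 0 < (2 : ENNReal).toReal := by norm_num
  have hmem (f : E) : Memℓp (fun i => m i * b.repr f i) 2 := by
    refine memℓp_gen (Summable.of_nonneg_of_le (fun i => by positivity) (fun i => ?_)
      (((lp.memℓp (b.repr f)).summable hp).mul_left (C ^ (2 : ENNReal).toReal)))
    rw [← Real.mul_rpow hC (norm_nonneg _), norm_mul]
    exact Real.rpow_le_rpow (by positivity)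
      (mul_le_mul_of_nonneg_right (hm i) (norm_nonneg _)) hp.le
  let T : E →ₗ[ℂ] E :=
    { toFun := fun f => b.repr.symm ⟨_, hmem f⟩
      map_add' := fun f g => by
        rw [← map_add]
        congr 1
        ext i
        simp only [map_add, lp.coeFn_add, Pi.add_apply, mul_add]
      map_smul' := fun c f => by
        rw [RingHom.id_apply, ← map_smul]
        congr 1
        ext i
        simp [mul_left_comm] }
  have hT (f : E) (i : ι) : b.repr (T f) i = m i * b.repr f i := by
    change b.repr (b.repr.symm ⟨_, hmem f⟩) i = _
    rw [LinearIsometryEquiv.apply_symm_apply]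
  have hn (f : E) : ‖T f‖ ≤ C * ‖f‖ := norm_le_mul_of_repr_le b hC fun i => by
    rw [hT, norm_mul]
    exact mul_le_mul_of_nonneg_right (hm i) (norm_nonneg _)
  exact ⟨T.mkContinuous C hn, hT, T.mkContinuous_norm_le hC hn⟩

lemma isCompactOperator_rankOne (x y : E) :
    IsCompactOperator ((innerSL ℂ x).smulRight y : E →L[ℂ] E) := by
  have h : IsCompactOperator (innerSL ℂ x : E →L[ℂ] ℂ) :=
    isCompactOperator_of_locallyCompactSpace_dom (innerSL ℂ x)
  exact h.clm_comp ((1 : ℂ →L[ℂ] ℂ).smulRight y)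

/-- The finite-rank truncations converge in operator norm: once the finite set where `‖m i‖ ≥ ε / 2`
is covered, the remainder has norm at most `ε / 2`. -/
lemma isCompactOperator_of_diagonal [CompleteSpace E] (b : HilbertBasis ι ℂ E) {m : ι → ℂ}
    {T : E →L[ℂ] E} (hT : ∀ f i, b.repr (T f) i = m i * b.repr f i)
    (hm : Tendsto m cofinite (𝓝 0)) : IsCompactOperator T := by
  classical
  let F (s : Finset ι) : E →L[ℂ] E := ∑ i ∈ s, (innerSL ℂ (b i)).smulRight (m i • b i)
  have hF (s : Finset ι) (f : E) (j : ι) :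
      b.repr (F s f) j = if j ∈ s then m j * b.repr f j else 0 := by
    simp only [F, b.repr_apply_apply, sum_apply, inner_sum,
      ContinuousLinearMap.smulRight_apply, innerSL_apply_apply, inner_smul_right,
      orthonormal_iff_ite.mp b.orthonormal, mul_ite, mul_one, mul_zero, Finset.sum_ite_eq]
    split_ifs
    · ring
    · rfl
  have hlim : Tendsto F atTop (𝓝 T) := by
    rw [Metric.tendsto_atTop]
    intro ε hε
    have hfin : {i | ¬ ‖m i‖ < ε / 2}.Finite :=
      (tendsto_zero_iff_norm_tendsto_zero.mp hm).eventually (gt_mem_nhds (half_pos hε))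
    refine ⟨hfin.toFinset, fun s hs => ?_⟩
    rw [dist_eq_norm]
    refine (ContinuousLinearMap.opNorm_le_bound _ (half_pos hε).le fun f => ?_).trans_lt
      (half_lt_self hε)
    refine norm_le_mul_of_repr_le b (half_pos hε).le fun i => ?_
    rw [sub_apply, map_sub, lp.coeFn_sub, Pi.sub_apply, hF, hT]
    split_ifs with hi
    · rw [sub_self, norm_zero]
      positivity
    · have : ‖m i‖ < ε / 2 := by
        by_contra h
        exact hi (hs (by simpa using h))
      rw [zero_sub, norm_neg, norm_mul]
      exact mul_le_mul_of_nonneg_right this.le (norm_nonneg _)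
  refine isCompactOperator_of_tendsto hlim (Eventually.of_forall fun s => ?_)
  have : ∀ s : Finset ι, F s ∈ compactOperator (RingHom.id ℂ) E E := fun s =>
    Submodule.sum_mem _ fun i _ => isCompactOperator_rankOne _ _
  exact this s

end HilbertBasis

/-! ### The Laplacian on the torus in Fourier variables. -/

variable {d : ℕ}

lemma finite_laplaceSymbol_le (B : ℝ) : {k : Fin d → ℤ | laplaceSymbol k ≤ B}.Finite := by
  refine (Set.Finite.pi' fun _ : Fin d => Set.finite_Icc (-⌈|B|⌉) ⌈|B|⌉).subset ?_
  intro k hk i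
  have h1 : (k i : ℝ) ^ 2 ≤ |B| := by
    have h2 : (k i : ℝ) ^ 2 ≤ ∑ i, (k i : ℝ) ^ 2 :=
      Finset.single_le_sum (f := fun i => (k i : ℝ) ^ 2) (fun _ _ => sq_nonneg _)
        (Finset.mem_univ i)
    have h3 : (1 : ℝ) ≤ (2 * Real.pi) ^ 2 := by nlinarith [Real.pi_gt_three]
    have h4 : laplaceSymbol k ≤ B := hk
    unfold laplaceSymbol at h4
    nlinarith [le_abs_self B, sq_nonneg (k i : ℝ)]
  have h2 : (|k i| : ℤ) ≤ ⌈|B|⌉ := by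
    have h3 : |k i| ≤ k i ^ 2 := by
      rw [← sq_abs]
      rcases (abs_nonneg (k i)).eq_or_lt with h | h
      · rw [← h]; norm_num
      · nlinarith
    refine Int.le_ceil_iff.mpr ?_
    have : ((|k i| : ℤ) : ℝ) ≤ |B| := le_trans (by exact_mod_cast h3) h1
    linarith
  exact Set.mem_Icc.mpr (abs_le.mp h2)

lemma tendsto_laplaceSymbol : Tendsto (laplaceSymbol (d := d)) cofinite atTop :=
  tendsto_atTop.mpr fun B => by
    refine ((finite_laplaceSymbol_le (d := d) B).subset fun k hk => ?_)
    exact (not_le.mp (show ¬ B ≤ laplaceSymbol k from hk)).le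

lemma fourierCoef_negLaplacian (f : H2 d) (k : Fin d → ℤ) :
    fourierCoef (negLaplacian d f) k = laplaceSymbol k * fourierCoef (f : H0 d) k := by
  simp [negLaplacian, fourierCoef]

lemma fourierCoef_injective {f g : H0 d} (h : ∀ k, fourierCoef f k = fourierCoef g k) : f = g :=
  UnitAddTorus.mFourierBasis.repr.injective (lp.ext (funext h))

lemma fourierCoef_eq_inner (f : H0 d) (k : Fin d → ℤ) :
    fourierCoef f k = inner ℂ (UnitAddTorus.mFourierBasis k : H0 d) f :=
  HilbertBasis.repr_apply_apply _ _ _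

/-- Elliptic regularity: `(1 + s)² ≤ 2 (1 + s²)`, and both `f` and `g` have square-summable
coefficients. -/
lemma mem_H2_of_fourierCoef {f g : H0 d}
    (h : ∀ k, fourierCoef g k = laplaceSymbol k * fourierCoef f k) : f ∈ H2 d := by
  have hs (f : H0 d) : Summable fun k => ‖fourierCoef f k‖ ^ 2 := by
    have := (lp.memℓp (UnitAddTorus.mFourierBasis.repr f)).summable
      (p := 2) (by norm_num)
    simpa [fourierCoef] using this
  refine Summable.of_nonneg_of_le (fun k => by positivity) (fun k => ?_)
    (((hs f).add (hs g)).mul_left 2)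
  rw [h, norm_mul, Complex.norm_real, Real.norm_of_nonneg (laplaceSymbol_nonneg k)]
  nlinarith [mul_nonneg (sq_nonneg (1 - laplaceSymbol k)) (sq_nonneg ‖fourierCoef f k‖)]

lemma negLaplacian_eq_of_fourierCoef {f : H2 d} {g : H0 d}
    (h : ∀ k, fourierCoef g k = laplaceSymbol k * fourierCoef (f : H0 d) k) :
    negLaplacian d f = g :=
  fourierCoef_injective fun k => by rw [fourierCoef_negLaplacian, h]

lemma inner_negLaplacian (f g : H2 d) :
    inner ℂ (negLaplacian d f) (g : H0 d) = inner ℂ (f : H0 d) (negLaplacian d g) := by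
  rw [← UnitAddTorus.mFourierBasis.repr.inner_map_map,
    ← UnitAddTorus.mFourierBasis.repr.inner_map_map (f : H0 d), lp.inner_eq_tsum, lp.inner_eq_tsum]
  refine tsum_congr fun k => ?_
  change inner ℂ (fourierCoef (negLaplacian d f) k) (fourierCoef (g : H0 d) k)
    = inner ℂ (fourierCoef (f : H0 d) k) (fourierCoef (negLaplacian d g) k)
  simp only [fourierCoef_negLaplacian, RCLike.inner_apply, map_mul, Complex.conj_ofReal]
  ring

/-- The resolvent `(c - Δ)⁻¹` exists, is compact, and is bounded by `c⁻¹`. -/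
lemma exists_resolvent_negLaplacian (d : ℕ) {c : ℝ} (hc : 0 < c) :
    ∃ R : H0 d →L[ℂ] H0 d, IsCompactOperator R ∧ ‖R‖ ≤ c⁻¹ ∧
      (∀ f, ∃ u : H2 d, (u : H0 d) = R f ∧ negLaplacian d u + (c : ℂ) • (u : H0 d) = f) ∧
      ∀ u : H2 d, R (negLaplacian d u + (c : ℂ) • (u : H0 d)) = u := by
  have hpos (k : Fin d → ℤ) : 0 < laplaceSymbol k + c :=
    add_pos_of_nonneg_of_pos (laplaceSymbol_nonneg k) hc
  have hne (k : Fin d → ℤ) : (laplaceSymbol k : ℂ) + c ≠ 0 := by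
    exact_mod_cast (hpos k).ne'
  obtain ⟨R, hR, hRn⟩ := exists_diagonal (UnitAddTorus.mFourierBasis (d := Fin d))
    (fun k => (((laplaceSymbol k + c)⁻¹ : ℝ) : ℂ)) (inv_nonneg.mpr hc.le) (fun k => by
      rw [Complex.norm_real, Real.norm_of_nonneg (inv_nonneg.mpr (hpos k).le)]
      exact inv_anti₀ hc (le_add_of_nonneg_left (laplaceSymbol_nonneg k)))
  have hR' (f : H0 d) (k) : fourierCoef (R f) k = (laplaceSymbol k + c : ℂ)⁻¹ * fourierCoef f k := by
    have := hR f k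
    push_cast at this
    exact this
  -- The identity `-Δ R f = f - c R f` on coefficients; it gives both `R f ∈ H²` and the right
  -- inverse.
  have hlap (f : H0 d) (k) : fourierCoef (f + (-c : ℂ) • R f) k
      = laplaceSymbol k * fourierCoef (R f) k := by
    rw [fourierCoef_add, fourierCoef_smul, hR']
    field_simp [hne k]
    ring
  refine ⟨R, isCompactOperator_of_diagonal _ hR ?_, hRn, fun f => ?_, fun u => ?_⟩
  · have : Tendsto (fun k : Fin d → ℤ => (laplaceSymbol k + c)⁻¹) cofinite (𝓝 0) :=
      tendsto_inv_atTop_zero.comp (tendsto_atTop_add_const_right _ _ tendsto_laplaceSymbol)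
    simpa [Function.comp_def] using (Complex.continuous_ofReal.tendsto 0).comp this
  · refine ⟨⟨R f, mem_H2_of_fourierCoef (hlap f)⟩, rfl, ?_⟩
    rw [negLaplacian_eq_of_fourierCoef (f := ⟨R f, _⟩) (hlap f)]
    simp
  · refine fourierCoef_injective fun k => ?_
    rw [hR', fourierCoef_add, fourierCoef_smul, fourierCoef_negLaplacian]
    field_simp [hne k]

/-- Rellich: a sequence bounded in `H²` has a subsequence that converges in `H⁰`. -/
lemma exists_subseq_tendsto_of_bounded (u : ℕ → H2 d) {B C : ℝ} (hB : ∀ n, ‖(u n : H0 d)‖ ≤ B)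
    (hC : ∀ n, ‖negLaplacian d (u n)‖ ≤ C) :
    ∃ x : H0 d, ∃ φ : ℕ → ℕ, StrictMono φ ∧ Tendsto (fun n => (u (φ n) : H0 d)) atTop (𝓝 x) := by
  -- Every `u n` is the image under the compact `(1 - Δ)⁻¹` of a vector of norm at most `C + B`.
  obtain ⟨R, hR, -, -, hRu⟩ := exists_resolvent_negLaplacian d one_pos
  have hK := hR.isCompact_closure_image_closedBall (f := (R : H0 d →ₗ[ℂ] H0 d)) (C + B)
  obtain ⟨x, -, φ, hφ, hx⟩ := hK.tendsto_subseq (x := fun n => (u n : H0 d)) fun n => by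
    refine subset_closure ⟨_, ?_, hRu (u n)⟩
    rw [mem_closedBall_zero_iff]
    refine (norm_add_le _ _).trans (add_le_add (hC n) ?_)
    simpa using hB n
  exact ⟨x, φ, hφ, hx⟩

/-! ### Compact resolvents of Schrödinger operators. -/

/-- The spectral theorem for the restriction to `V`: its eigenspaces have trivial orthogonal
complement in `V`, so they cannot all vanish unless `V` does. -/
lemma exists_eigenvector_mem_of_isCompactOperator {E : Type*} [NormedAddCommGroup E]
    [InnerProductSpace ℂ E] {S : E →L[ℂ] E} (hS : IsCompactOperator S)
    (hS' : (S : E →ₗ[ℂ] E).IsSymmetric) {V : Submodule ℂ E} [CompleteSpace V]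
    (hV : ∀ x ∈ V, S x ∈ V) (hne : V ≠ ⊥) :
    ∃ x ∈ V, x ≠ 0 ∧ ∃ μ : ℝ, S x = (μ : ℂ) • x := by
  let T : V →L[ℂ] V := S.restrict hV
  have hT : IsCompactOperator T := hS.restrict' hV
  have hT' : (T : V →ₗ[ℂ] V).IsSymmetric := hS'.restrict_invariant hV
  have hbot := ContinuousLinearMap.orthogonalComplement_iSup_eigenspaces_eq_bot hT hT'
  obtain ⟨μ, hμ⟩ : ∃ μ, Module.End.HasEigenvalue (T : Module.End ℂ V) μ := by
    by_contra! h
    have h0 : ∀ μ, Module.End.eigenspace (T : Module.End ℂ V) μ = ⊥ := fun μ => by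
      simpa [Module.End.hasEigenvalue_iff] using h μ
    simp only [h0, iSup_bot, Submodule.bot_orthogonal_eq_top] at hbot
    have : Subsingleton V := Submodule.subsingleton_iff ℂ |>.mp (subsingleton_of_bot_eq_top hbot.symm)
    exact hne (Submodule.subsingleton_iff_eq_bot.mp this)
  obtain ⟨x, hx, hx0⟩ := hμ.exists_hasEigenvector
  have hreal := hT'.conj_eigenvalue_eq_self hμ
  refine ⟨x, x.2, fun h => hx0 (Subtype.ext h), μ.re, ?_⟩
  rw [Complex.conj_eq_iff_re.mp hreal]
  exact congrArg Subtype.val (Module.End.mem_eigenspace_iff.mp hx)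

lemma schrodinger_apply (K : H0 d →L[ℂ] H0 d) (u : H2 d) :
    schrodinger K u = negLaplacian d u + K u := rfl

lemma inner_schrodinger {K : H0 d →L[ℂ] H0 d} (hK : IsSelfAdjoint K) (f g : H2 d) :
    inner ℂ (schrodinger K f) (g : H0 d) = inner ℂ (f : H0 d) (schrodinger K g) := by
  rw [schrodinger_apply, schrodinger_apply, inner_add_left, inner_add_right, inner_negLaplacian]
  congr 1
  exact hK.isSymmetric f g

/-- For large `c`, the resolvent `(-Δ + K + c)⁻¹` exists, is compact and symmetric. -/
lemma exists_resolvent_schrodinger {K : H0 d →L[ℂ] H0 d} (hK : IsSelfAdjoint K) :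
    ∃ (c : ℝ) (S : H0 d →L[ℂ] H0 d), IsCompactOperator S ∧
      (S : H0 d →ₗ[ℂ] H0 d).IsSymmetric ∧
      (∀ f, ∃ u : H2 d, (u : H0 d) = S f ∧ schrodinger K u + (c : ℂ) • (u : H0 d) = f) ∧
      ∀ u : H2 d, S (schrodinger K u + (c : ℂ) • (u : H0 d)) = u := by
  -- With this `c`, `‖K R‖ ≤ ‖K‖ / c < 1`, so the factorization `-Δ + K + c = (1 + K R)(-Δ + c)` is
  -- inverted by a Neumann series.
  obtain ⟨c, hc⟩ : ∃ c : ℝ, c = ‖K‖ + 1 := ⟨_, rfl⟩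
  have hc0 : 0 < c := hc ▸ add_pos_of_nonneg_of_pos (norm_nonneg K) one_pos
  obtain ⟨R, hR, hRn, hR1, hR2⟩ := exists_resolvent_negLaplacian d hc0
  have hlt : ‖-(K * R)‖ < 1 := by
    rw [norm_neg]
    calc ‖K * R‖ ≤ ‖K‖ * ‖R‖ := norm_mul_le _ _
      _ ≤ ‖K‖ * c⁻¹ := by gcongr
      _ < 1 := by rw [← div_eq_mul_inv, div_lt_one hc0]; linarith
  let W := Units.oneSub _ hlt
  have hW (g : H0 d) : (W : H0 d →L[ℂ] H0 d) g = g + K (R g) := by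
    simp [W, Units.val_oneSub]
  have hW1 (f : H0 d) : (W : H0 d →L[ℂ] H0 d) ((W⁻¹ : (H0 d →L[ℂ] H0 d)ˣ).1 f) = f :=
    congrArg (fun T : H0 d →L[ℂ] H0 d => T f) W.mul_inv
  have hW2 (f : H0 d) : (W⁻¹ : (H0 d →L[ℂ] H0 d)ˣ).1 ((W : H0 d →L[ℂ] H0 d) f) = f :=
    congrArg (fun T : H0 d →L[ℂ] H0 d => T f) W.inv_mul
  let S : H0 d →L[ℂ] H0 d := R * (W⁻¹ : (H0 d →L[ℂ] H0 d)ˣ).1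
  have hS1 : ∀ f, ∃ u : H2 d, (u : H0 d) = S f ∧ schrodinger K u + (c : ℂ) • (u : H0 d) = f := by
    intro f
    obtain ⟨u, hu, hu'⟩ := hR1 ((W⁻¹ : (H0 d →L[ℂ] H0 d)ˣ).1 f)
    refine ⟨u, hu, ?_⟩
    rw [schrodinger_apply, add_right_comm, hu', hu, ← hW, hW1]
  refine ⟨c, S, hR.comp_clm _, fun f g => ?_, hS1, fun u => ?_⟩
  -- Writing both arguments as images of `-Δ + K + c` reduces symmetry of `S` to symmetry of that
  -- operator.
  · obtain ⟨u, hu, rfl⟩ := hS1 f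
    obtain ⟨x, hx, rfl⟩ := hS1 g
    change inner ℂ (S _) _ = inner ℂ _ (S _)
    rw [← hu, ← hx, inner_add_left, inner_add_right, inner_schrodinger hK, inner_smul_left,
      inner_smul_right, Complex.conj_ofReal]
  · have h := hW (negLaplacian d u + (c : ℂ) • (u : H0 d))
    rw [hR2] at h
    rw [schrodinger_apply, add_right_comm, ← h]
    change R ((W⁻¹ : (H0 d →L[ℂ] H0 d)ˣ).1 _) = _
    rw [hW2, hR2]

/-! ### Completeness of the enumerated eigenfunctions. -/

variable {K : H0 d →L[ℂ] H0 d} {α : ℕ → ℝ} {v : ℕ → H2 d}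

/-- The eigenvalues of `-Δ + K` in an enumeration are unbounded. -/
lemma IsEigenEnumeration.exists_lt (hv : IsEigenEnumeration (schrodinger K) α v) (μ : ℝ) :
    ∃ n, μ < α n := by
  -- Bounded eigenvalues would bound `v` in `H²`; Rellich then gives a convergent subsequence,
  -- although orthonormal vectors stay at distance `√2`.
  by_contra! h
  have hone (n : ℕ) : ‖(v n : H0 d)‖ = 1 := hv.orthonormal.1 n
  obtain ⟨x, φ, hφ, hx⟩ := exists_subseq_tendsto_of_bounded v (B := 1)
    (C := |α 0| + |μ| + ‖K‖) (fun n => (hone n).le) fun n => by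
      have h1 : negLaplacian d (v n) = (α n : ℂ) • (v n : H0 d) - K (v n) := by
        rw [← hv.eigen, schrodinger_apply, add_sub_cancel_right]
      rw [h1]
      refine (norm_sub_le _ _).trans (add_le_add ?_ (K.le_opNorm_of_le (hone n).le |>.trans ?_))
      · rw [norm_smul, hone, mul_one, Complex.norm_real, Real.norm_eq_abs, abs_le]
        have h2 := hv.ascending (Nat.zero_le n)
        have h3 := h n
        constructor
        · linarith [neg_abs_le (α 0), abs_nonneg μ]
        · linarith [le_abs_self μ, abs_nonneg (α 0)]
      · rw [mul_one]
  have hdiff := ((hx.comp (tendsto_add_atTop_nat 1)).sub hx).norm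
  rw [sub_self, norm_zero] at hdiff
  have h2 (n : ℕ) : ‖(v (φ (n + 1)) : H0 d) - v (φ n)‖ ^ 2 = 2 := by
    rw [@norm_sub_sq ℂ, hv.orthonormal.2 (hφ (Nat.lt_succ_self n)).ne', hone, hone]
    norm_num
  have h3 := hdiff.pow 2
  simp only [Function.comp_apply, h2] at h3
  have := tendsto_nhds_unique h3 tendsto_const_nhds
  norm_num at this

/-- The orthogonal complement is invariant under the compact symmetric resolvent, so if nonzero it
contains an eigenvector. By `first`, its eigenvalue bounds every `α n`, contradicting unboundedness.
-/
lemma IsEigenEnumeration.orthogonal_span_eq_bot (hK : IsSelfAdjoint K)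
    (hv : IsEigenEnumeration (schrodinger K) α v) :
    (Submodule.span ℂ (Set.range fun j => (v j : H0 d)))ᗮ = ⊥ := by
  obtain ⟨c, S, hS, hS', hS1, hS2⟩ := exists_resolvent_schrodinger hK
  have hne (j : ℕ) : (v j : H0 d) ≠ 0 := hv.orthonormal.ne_zero j
  have hSv (j : ℕ) : ((α j : ℂ) + c) • S (v j) = v j := by
    rw [← map_smul, add_smul, ← hv.eigen, hS2]
  have hmem (x : H0 d) : x ∈ (Submodule.span ℂ (Set.range fun j => (v j : H0 d)))ᗮ ↔
      ∀ j, inner ℂ (v j : H0 d) x = 0 := by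
    refine ⟨fun h j => h _ (Submodule.subset_span ⟨j, rfl⟩), fun h y hy => ?_⟩
    induction hy using Submodule.span_induction with
    | mem y hy =>
      obtain ⟨j, rfl⟩ := hy
      exact h j
    | zero => exact inner_zero_left _
    | add y z _ _ hy hz => rw [inner_add_left, hy, hz, add_zero]
    | smul a y _ hy => rw [inner_smul_left, hy, mul_zero]
  by_contra hbot
  obtain ⟨x, hxV, hx0, μ, hμ⟩ := exists_eigenvector_mem_of_isCompactOperator hS hS'
    (V := (Submodule.span ℂ (Set.range fun j => (v j : H0 d)))ᗮ) (fun x hx => by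
      rw [hmem] at hx ⊢
      intro j
      have hαc : (starRingEnd ℂ) ((α j : ℂ) + c) ≠ 0 := fun h => hne j (by
        rw [map_eq_zero] at h
        rw [← hSv, h, zero_smul])
      refine (mul_eq_zero.mp ?_).resolve_left hαc
      have h1 : inner ℂ (S (v j)) x = inner ℂ (v j : H0 d) (S x) := hS' _ _
      rw [← h1, ← inner_smul_left, hSv, hx]) hbot
  obtain ⟨u, hu, hu'⟩ := hS1 x
  rw [hμ] at hu
  -- The resolvent is injective, so its eigenvalue `μ` can be inverted to the eigenvalue `μ⁻¹ - c`
  -- of `-Δ + K`.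
  have hμ0 : (μ : ℂ) ≠ 0 := fun h => hx0 (by
    rw [h, zero_smul] at hu
    rw [← hu', hu, Subtype.ext hu (a2 := (0 : H2 d)), map_zero, smul_zero, add_zero])
  have hu0 : u ≠ 0 := fun h => by
    rw [h] at hu
    exact (smul_ne_zero hμ0 hx0) hu.symm
  have hAu : schrodinger K u = ((μ⁻¹ - c : ℝ) : ℂ) • (u : H0 d) := by
    have h1 : x = (μ : ℂ)⁻¹ • (u : H0 d) := by rw [hu, inv_smul_smul₀ hμ0]
    rw [eq_sub_of_add_eq hu', h1]
    push_cast
    rw [sub_smul]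
  obtain ⟨n, hn⟩ := hv.exists_lt (μ⁻¹ - c)
  refine absurd (hv.first n _ u hu0 hAu fun j _ => ?_) (not_le.mpr hn)
  rw [hu, inner_smul_right, (hmem x).mp hxV j, mul_zero]

lemma firstSpan_mono (v : ℕ → H2 d) : Monotone (firstSpan v) := fun m n hmn =>
  Submodule.span_mono (by
    rintro _ ⟨j, rfl⟩
    exact ⟨Fin.castLE hmn j, rfl⟩)

lemma IsEigenEnumeration.tendsto_starProjection (hK : IsSelfAdjoint K)
    (hv : IsEigenEnumeration (schrodinger K) α v) (x : H0 d) :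
    Tendsto (fun n => (firstSpan v n).starProjection x) atTop (𝓝 x) := by
  refine Submodule.starProjection_tendsto_self _ (firstSpan_mono v) x ?_
  have hle : Submodule.span ℂ (Set.range fun j => (v j : H0 d)) ≤ ⨆ n, firstSpan v n := by
    rw [Submodule.span_le]
    rintro _ ⟨j, rfl⟩
    exact Submodule.mem_iSup_of_mem (j + 1)
      (Submodule.subset_span ⟨⟨j, Nat.lt_succ_self j⟩, rfl⟩)
  have hbot : (⨆ n, firstSpan v n)ᗮ = ⊥ :=
    le_bot_iff.mp ((Submodule.orthogonal_le hle).trans (hv.orthogonal_span_eq_bot hK).le)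
  rw [← Submodule.orthogonal_orthogonal_eq_closure, hbot, Submodule.bot_orthogonal_eq_top]

lemma IsEigenEnumeration.schrodinger_mem_firstSpan (hv : IsEigenEnumeration (schrodinger K) α v)
    {n : ℕ} (u : H2 d) (hu : (u : H0 d) ∈ firstSpan v n) : schrodinger K u ∈ firstSpan v n := by
  suffices h : ∀ x ∈ firstSpan v n, ∀ hx : x ∈ H2 d, schrodinger K ⟨x, hx⟩ ∈ firstSpan v n from
    h u hu u.2
  intro x hx
  induction hx using Submodule.span_induction with
  | mem x hx =>
    obtain ⟨j, rfl⟩ := hx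
    intro _
    rw [hv.eigen]
    exact Submodule.smul_mem _ _ (Submodule.subset_span ⟨j, rfl⟩)
  | zero =>
    intro _
    change schrodinger K 0 ∈ _
    rw [map_zero]
    exact Submodule.zero_mem _
  | add x y hx' hy' hx hy =>
    intro _
    have h := Submodule.add_mem _ (hx (firstSpan_le v n hx')) (hy (firstSpan_le v n hy'))
    rwa [← map_add] at h
  | smul a x hx' hx =>
    intro _
    have h := Submodule.smul_mem _ a (hx (firstSpan_le v n hx'))
    rwa [← map_smul] at h

/-! ### A priori bound and passage to the limit in one row. -/

lemma tendsto_clm_apply {E F : Type*} [NormedAddCommGroup E] [NormedSpace ℂ E]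
    [NormedAddCommGroup F] [NormedSpace ℂ F] {K : ℕ → E →L[ℂ] F} {K' : E →L[ℂ] F} {C : ℝ}
    (hC : ∀ k, ‖K k‖ ≤ C) (hK : ∀ x, Tendsto (fun k => K k x) atTop (𝓝 (K' x)))
    {x : ℕ → E} {y : E} (hx : Tendsto x atTop (𝓝 y)) :
    Tendsto (fun k => K k (x k)) atTop (𝓝 (K' y)) := by
  have h1 : Tendsto (fun k => K k (x k - y)) atTop (𝓝 0) := by
    refine squeeze_zero_norm (fun k => (K k).le_of_opNorm_le (hC k) _) ?_
    have h2 := ((tendsto_sub_nhds_zero_iff.mpr hx).norm).const_mul C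
    rwa [norm_zero, mul_zero] at h2
  simpa using h1.add (hK y)

/-- Strong convergence does not pass to adjoints, but weak convergence does: the operator is moved
onto the fixed vector `e`. -/
lemma tendsto_inner_adjoint_apply {E F : Type*} [NormedAddCommGroup E] [InnerProductSpace ℂ E]
    [CompleteSpace E] [NormedAddCommGroup F] [InnerProductSpace ℂ F] [CompleteSpace F]
    {K : ℕ → E →L[ℂ] F} {K' : E →L[ℂ] F} (hK : ∀ x, Tendsto (fun k => K k x) atTop (𝓝 (K' x)))
    {x : ℕ → F} {y : F} (hx : Tendsto x atTop (𝓝 y)) (e : E) :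
    Tendsto (fun k => inner ℂ e ((K k).adjoint (x k))) atTop (𝓝 (inner ℂ e (K'.adjoint y))) := by
  simp only [ContinuousLinearMap.adjoint_inner_right]
  exact (hK e).inner hx

/-- If `P_n (-Δ + L) u = P_n g` for some `u` in the range of `P_n`, then `-Δ u` is controlled by
the lower order terms. -/
lemma IsEigenEnumeration.negLaplacian_eq (hv : IsEigenEnumeration (schrodinger K) α v) {n : ℕ}
    {L : H0 d →L[ℂ] H0 d} {u : H2 d} (hu : (u : H0 d) ∈ firstSpan v n) {g : H0 d}
    (h : (firstSpan v n).starProjection (schrodinger L u) = (firstSpan v n).starProjection g) :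
    negLaplacian d u = (firstSpan v n).starProjection (g + K u - L u) - K u := by
  -- Invariance lets the projection be dropped from `-Δ + K`, with `K` the perturbation defining
  -- `v`; it remains only on bounded terms.
  have h1 : (firstSpan v n).starProjection (schrodinger K u) = schrodinger K u :=
    Submodule.starProjection_eq_self_iff.mpr (hv.schrodinger_mem_firstSpan u hu)
  have h2 : schrodinger K u = schrodinger L u + (K u - L u) := by
    rw [schrodinger_apply, schrodinger_apply]
    abel
  rw [add_sub_assoc, map_add, ← h, ← map_add, ← h2, h1, schrodinger_apply, add_sub_cancel_right]

lemma norm_negLaplacian_le (hv : IsEigenEnumeration (schrodinger K) α v) {n : ℕ}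
    {L : H0 d →L[ℂ] H0 d} {u : H2 d} (hu : (u : H0 d) ∈ firstSpan v n) {g : H0 d}
    (h : (firstSpan v n).starProjection (schrodinger L u) = (firstSpan v n).starProjection g)
    {B C : ℝ} (hu1 : ‖(u : H0 d)‖ ≤ 1) (hg : ‖g‖ ≤ B) (hL : ‖L‖ ≤ C) :
    ‖negLaplacian d u‖ ≤ B + ‖K‖ + C + ‖K‖ := by
  have hK1 : ‖K u‖ ≤ ‖K‖ := by simpa using K.le_opNorm_of_le hu1
  have hL1 : ‖L u‖ ≤ C := (by simpa using L.le_opNorm_of_le hu1 : ‖L u‖ ≤ ‖L‖).trans hL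
  rw [hv.negLaplacian_eq hu h]
  refine (norm_sub_le _ _).trans (add_le_add ?_ hK1)
  refine (Submodule.norm_starProjection_apply_le _ _).trans ?_
  exact (norm_sub_le _ _).trans (add_le_add ((norm_add_le _ _).trans (add_le_add hg hK1)) hL1)

/-- Pairing with a Fourier mode `e` moves the projection onto `e`, where it converges strongly, so
weak convergence of the bounded `g k` suffices. The limit of the coefficient of `-Δ (u k)`, computed
in two ways, gives both membership in `H²` and the equation. -/
lemma exists_negLaplacian_eq_of_tendsto (hK : IsSelfAdjoint K)
    (hv : IsEigenEnumeration (schrodinger K) α v) {n : ℕ → ℕ} (hn : Tendsto n atTop atTop)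
    {L : ℕ → H0 d →L[ℂ] H0 d} {L' : H0 d →L[ℂ] H0 d} {C : ℝ} (hC : ∀ k, ‖L k‖ ≤ C)
    (hL : ∀ x, Tendsto (fun k => L k x) atTop (𝓝 (L' x)))
    {u : ℕ → H2 d} (hu : ∀ k, (u k : H0 d) ∈ firstSpan v (n k)) {g : ℕ → H0 d}
    (h : ∀ k, (firstSpan v (n k)).starProjection (schrodinger (L k) (u k))
      = (firstSpan v (n k)).starProjection (g k))
    {B : ℝ} (hg : ∀ k, ‖g k‖ ≤ B) {g' : H0 d}
    (hg' : ∀ e, Tendsto (fun k => inner ℂ e (g k)) atTop (𝓝 (inner ℂ e g')))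
    {u' : H0 d} (hu' : Tendsto (fun k => (u k : H0 d)) atTop (𝓝 u')) :
    ∃ hmem : u' ∈ H2 d, schrodinger L' ⟨u', hmem⟩ = g' := by
  have hLu := tendsto_clm_apply hC hL hu'
  have hKu : Tendsto (fun k => K (u k)) atTop (𝓝 (K u')) := (K.continuous.tendsto u').comp hu'
  have hcoef (m : Fin d → ℤ) :
      fourierCoef (g' - L' u') m = laplaceSymbol m * fourierCoef u' m := by
    obtain ⟨e, he⟩ : ∃ e : H0 d, ∀ f : H0 d, fourierCoef f m = inner ℂ e f :=
      ⟨_, fun f => fourierCoef_eq_inner f m⟩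
    have hpe : Tendsto (fun k => (firstSpan v (n k)).starProjection e) atTop (𝓝 e) :=
      (hv.tendsto_starProjection hK e).comp hn
    have hdiff : Tendsto (fun k => inner ℂ ((firstSpan v (n k)).starProjection e - e) (g k)) atTop
        (𝓝 0) := by
      refine squeeze_zero_norm (fun k => (norm_inner_le_norm _ _).trans
        (mul_le_mul_of_nonneg_left (hg k) (norm_nonneg _))) ?_
      have h2 := ((tendsto_sub_nhds_zero_iff.mpr hpe).norm).mul_const B
      rwa [norm_zero, zero_mul] at h2
    have hPg : Tendsto (fun k => inner ℂ ((firstSpan v (n k)).starProjection e) (g k)) atTop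
        (𝓝 (inner ℂ e g')) := by
      simpa [inner_sub_left] using hdiff.add (hg' e)
    have hlim : Tendsto (fun k => fourierCoef (negLaplacian d (u k)) m) atTop
        (𝓝 (inner ℂ e g' + inner ℂ e (K u') - inner ℂ e (L' u') - inner ℂ e (K u'))) := by
      have h3 (k : ℕ) : fourierCoef (negLaplacian d (u k)) m
          = inner ℂ ((firstSpan v (n k)).starProjection e) (g k)
            + inner ℂ ((firstSpan v (n k)).starProjection e) (K (u k))
            - inner ℂ ((firstSpan v (n k)).starProjection e) (L k (u k))
            - inner ℂ e (K (u k)) := by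
        rw [he, hv.negLaplacian_eq (hu k) (h k), inner_sub_right,
          ← Submodule.inner_starProjection_left_eq_right, inner_sub_right, inner_add_right]
      simp only [h3]
      exact ((hPg.add (hpe.inner hKu)).sub (hpe.inner hLu)).sub (tendsto_const_nhds.inner hKu)
    have hlim' : Tendsto (fun k => fourierCoef (negLaplacian d (u k)) m) atTop
        (𝓝 (laplaceSymbol m * fourierCoef u' m)) := by
      have h3 : Tendsto (fun k => fourierCoef (u k : H0 d) m) atTop (𝓝 (fourierCoef u' m)) := by
        simp only [he]
        exact Tendsto.inner (𝕜 := ℂ) tendsto_const_nhds hu'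
      simp only [fourierCoef_negLaplacian]
      exact h3.const_mul _
    rw [← tendsto_nhds_unique hlim hlim', he, inner_sub_right]
    ring
  refine ⟨mem_H2_of_fourierCoef hcoef, ?_⟩
  rw [schrodinger_apply, negLaplacian_eq_of_fourierCoef (f := ⟨u', _⟩) hcoef, sub_add_cancel]

/-! ### Eigenvectors of the truncations and of the limit. -/

lemma mem_spectrumPMap_of_eigenvector {E : Type*} [NormedAddCommGroup E] [NormedSpace ℂ E]
    {T : E →ₗ.[ℂ] E} {z : ℂ} (x : T.domain) (hx : (x : E) ≠ 0) (h : T x = z • (x : E)) :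
    z ∈ spectrumPMap T := by
  rintro ⟨R, -, hR⟩
  exact hx (by rw [← hR x, h, sub_self, map_zero])

/-- A point of the spectrum of the truncated matrix has a normalized eigenvector. -/
lemma exists_normalized_eigenvector {K₁ K₂ K : H0 d →L[ℂ] H0 d} {v w : ℕ → H2 d} {n : ℕ} {σ : ℂ}
    (h : σ ∈ spectrum ℂ (truncMatrixOp K₁ K₂ K v w n)) :
    ∃ u z : H2 d, (u : H0 d) ∈ firstSpan v n ∧ (z : H0 d) ∈ firstSpan w n ∧
      ‖(u : H0 d)‖ ^ 2 + ‖(z : H0 d)‖ ^ 2 = 1 ∧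
      (firstSpan v n).starProjection (schrodinger K₁ u)
        = (firstSpan v n).starProjection (σ • (u : H0 d) - K z) ∧
      (firstSpan w n).starProjection (schrodinger K₂ z)
        = (firstSpan w n).starProjection (K.adjoint u - σ • (z : H0 d)) := by
  have : FiniteDimensional ℂ (WithLp 2 (firstSpan v n × firstSpan w n)) :=
    (WithLp.linearEquiv 2 ℂ (firstSpan v n × firstSpan w n)).symm.finiteDimensional
  obtain ⟨Y, hY, hY0⟩ := (Module.End.HasEigenvalue.of_mem_spectrum h).exists_hasEigenvector
  obtain ⟨X, hX, hX1⟩ : ∃ X, truncMatrixOp K₁ K₂ K v w n X = σ • X ∧ ‖X‖ = 1 := by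
    refine ⟨((‖Y‖⁻¹ : ℝ) : ℂ) • Y, ?_, ?_⟩
    · rw [map_smul, Module.End.mem_eigenspace_iff.mp hY, smul_comm]
    · rw [norm_smul, Complex.norm_real, norm_inv, norm_norm, inv_mul_cancel₀ (norm_ne_zero_iff.mpr hY0)]
  have h1 : (firstSpan v n).starProjection (schrodinger K₁ ⟨X.fst, firstSpan_le v n X.fst.2⟩)
      + (firstSpan v n).starProjection (K X.snd) = σ • (X.fst : H0 d) :=
    congrArg (fun Z : WithLp 2 (firstSpan v n × firstSpan w n) => (Z.fst : H0 d)) hX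
  have h2 : (firstSpan w n).starProjection (K.adjoint X.fst)
      + -(firstSpan w n).starProjection (schrodinger K₂ ⟨X.snd, firstSpan_le w n X.snd.2⟩)
      = σ • (X.snd : H0 d) :=
    congrArg (fun Z : WithLp 2 (firstSpan v n × firstSpan w n) => (Z.snd : H0 d)) hX
  refine ⟨⟨X.fst, firstSpan_le v n X.fst.2⟩, ⟨X.snd, firstSpan_le w n X.snd.2⟩, X.fst.2, X.snd.2,
    ?_, ?_, ?_⟩
  · have := WithLp.prod_norm_sq_eq_of_L2 X
    rw [hX1, one_pow] at this
    exact this.symm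
  · rw [map_sub, map_smul, Submodule.starProjection_eq_self_iff.mpr X.fst.2, ← h1,
      add_sub_cancel_right]
  · rw [map_sub, map_smul, Submodule.starProjection_eq_self_iff.mpr X.snd.2, ← h2]
    abel

end TruncatedOperators

open TruncatedOperators

theorem mainTheorem8 (d : ℕ)
    (K₁ K₂ K : Set.Ico (0 : ℝ) 1 → H0 d →L[ℂ] H0 d)
    (hK₁ : IsAdmissibleFamily K₁) (hK₁_sa : ∀ l, IsSelfAdjoint (K₁ l))
    (hK₂ : IsAdmissibleFamily K₂) (hK₂_sa : ∀ l, IsSelfAdjoint (K₂ l))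
    (hK : IsAdmissibleFamily K)
    (α β : ℕ → ℝ) (v w : ℕ → H2 d)
    (hv : IsEigenEnumeration (schrodinger (K₁ ⟨0, by norm_num⟩)) α v)
    (hw : IsEigenEnumeration (schrodinger (K₂ ⟨0, by norm_num⟩)) β w)
    (σ : ℂ) (n : ℕ → ℕ) (hn : Tendsto n atTop atTop)
    (l : ℕ → Set.Ico (0 : ℝ) 1) (l₀ : Set.Ico (0 : ℝ) 1) (hl : Tendsto l atTop (𝓝 l₀))
    (hσ : ∀ k, σ ∈ spectrum ℂ (truncMatrixOp (K₁ (l k)) (K₂ (l k)) (K (l k)) v w (n k))) :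
    σ ∈ spectrumPMap (matrixOp (K₁ l₀) (K₂ l₀) (K l₀)) := by
  obtain ⟨C₁, hC₁⟩ := hK₁.bounded
  obtain ⟨C₂, hC₂⟩ := hK₂.bounded
  obtain ⟨C, hC⟩ := hK.bounded
  choose u z hu hz hnorm h1 h2 using fun k => exists_normalized_eigenvector (hσ k)
  have hu1 (k : ℕ) : ‖(u k : H0 d)‖ ≤ 1 := by
    nlinarith [hnorm k, sq_nonneg ‖(z k : H0 d)‖, norm_nonneg (u k : H0 d)]
  have hz1 (k : ℕ) : ‖(z k : H0 d)‖ ≤ 1 := by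
    nlinarith [hnorm k, sq_nonneg ‖(u k : H0 d)‖, norm_nonneg (z k : H0 d)]
  have hbdd {L : H0 d →L[ℂ] H0 d} {x : H0 d} (hL : ‖L‖ ≤ C) (hx : ‖x‖ ≤ 1) : ‖L x‖ ≤ C :=
    (by simpa using L.le_opNorm_of_le hx : ‖L x‖ ≤ ‖L‖).trans hL
  have hσx {x : H0 d} (hx : ‖x‖ ≤ 1) : ‖σ • x‖ ≤ ‖σ‖ := by
    rw [norm_smul]
    exact mul_le_of_le_one_right (norm_nonneg _) hx
  have hg1 (k : ℕ) : ‖σ • (u k : H0 d) - K (l k) (z k)‖ ≤ ‖σ‖ + C :=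
    (norm_sub_le _ _).trans (add_le_add (hσx (hu1 k)) (hbdd (hC _) (hz1 k)))
  have hg2 (k : ℕ) : ‖(K (l k)).adjoint (u k) - σ • (z k : H0 d)‖ ≤ C + ‖σ‖ :=
    (norm_sub_le _ _).trans (add_le_add
      (hbdd ((LinearIsometryEquiv.norm_map _ _).trans_le (hC _)) (hu1 k)) (hσx (hz1 k)))
  obtain ⟨u', φ, hφ, hu'⟩ := exists_subseq_tendsto_of_bounded u hu1 fun k =>
    norm_negLaplacian_le hv (hu k) (h1 k) (hu1 k) (hg1 k) (hC₁ _)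
  -- The second extraction runs along the first, so that both components converge along `φ ∘ ψ`.
  obtain ⟨z', ψ, hψ, hz'⟩ := exists_subseq_tendsto_of_bounded (fun k => z (φ k))
    (fun k => hz1 (φ k)) fun k =>
      norm_negLaplacian_le hw (hz (φ k)) (h2 (φ k)) (hz1 (φ k)) (hg2 (φ k)) (hC₂ _)
  replace hu' := hu'.comp hψ.tendsto_atTop
  have hsub : Tendsto (fun k => φ (ψ k)) atTop atTop := hφ.tendsto_atTop.comp hψ.tendsto_atTop
  have hl' : Tendsto (fun k => l (φ (ψ k))) atTop (𝓝 l₀) := hl.comp hsub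
  have hstrong (x : H0 d) : Tendsto (fun k => K (l (φ (ψ k))) x) atTop (𝓝 (K l₀ x)) :=
    (hK.strong l₀ x).comp hl'
  obtain ⟨hu2, hrow1⟩ := exists_negLaplacian_eq_of_tendsto (hK₁_sa _) hv (hn.comp hsub)
    (fun k => hC₁ (l (φ (ψ k)))) (fun x => (hK₁.strong l₀ x).comp hl') (fun k => hu (φ (ψ k)))
    (fun k => h1 (φ (ψ k))) (fun k => hg1 (φ (ψ k))) (g' := σ • u' - K l₀ z')
    (fun e => tendsto_const_nhds.inner
      ((hu'.const_smul σ).sub (tendsto_clm_apply (fun k => hC _) hstrong hz'))) hu'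
  -- Here the right side contains the adjoint of `K`, and only its weak convergence is available.
  obtain ⟨hz2, hrow2⟩ := exists_negLaplacian_eq_of_tendsto (hK₂_sa _) hw (hn.comp hsub)
    (fun k => hC₂ (l (φ (ψ k)))) (fun x => (hK₂.strong l₀ x).comp hl') (fun k => hz (φ (ψ k)))
    (fun k => h2 (φ (ψ k))) (fun k => hg2 (φ (ψ k))) (g' := (K l₀).adjoint u' - σ • z')
    (fun e => by
      simp only [inner_sub_right]
      exact (tendsto_inner_adjoint_apply hstrong hu' e).sub
        (tendsto_const_nhds.inner (hz'.const_smul σ))) hz'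
  -- Strong convergence preserves the normalization, which excludes a zero limit.
  have hlim : ‖u'‖ ^ 2 + ‖z'‖ ^ 2 = 1 :=
    tendsto_nhds_unique ((hu'.norm.pow 2).add (hz'.norm.pow 2))
      (tendsto_const_nhds.congr fun k => (hnorm (φ (ψ k))).symm)
  refine mem_spectrumPMap_of_eigenvector ⟨WithLp.toLp 2 (u', z'), hu2, hz2⟩ (fun h => ?_) ?_
  · have hu0 : u' = 0 := congrArg WithLp.fst h
    have hz0 : z' = 0 := congrArg WithLp.snd h
    simp [hu0, hz0] at hlim
  · change WithLp.toLp 2 (schrodinger (K₁ l₀) ⟨u', hu2⟩ + K l₀ z',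
      (K l₀).adjoint u' - schrodinger (K₂ l₀) ⟨z', hz2⟩) = σ • WithLp.toLp 2 (u', z')
    rw [hrow1, hrow2, ← WithLp.toLp_smul, sub_add_cancel, sub_sub_cancel, Prod.smul_mk]
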